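/- Let $(\mathcal X,\mathcal B)$ be a measurable space with a $\sigma$-finite reference measure $dx$, and let $\Pi$ be a probability measure on $\mathcal X$ that has a density with respect to $dx$. Let $\Theta$ be a Markov transition kernel on $\mathcal X$ that is - reversible with respect to $\Pi$: $\int_A\Theta(x,B)\,\Pi(dx)=\int_B\Theta(x,A)\,\Pi(dx)$ for all measurable $A,B$ (so $\Pi$ is stationary); - irreducible: for every $x\in\mathcal X$ and every measurable $A$ with $\Pi(A)>0$ there is $k\ge 0$ with $\Theta^k(x,A)>0$; - $\zeta$-lazy for some $\zeta\in(0,1]$: $\Theta(x,\cdot)=\zeta\,\delta_x+(1-\zeta)\,\Theta'(x,\cdot)$ for all $x$, for some Markov kernel $\Theta'$; - smooth: $\Theta(x,dy)=\theta(x,y)\,dy+\alpha_x\,\delta_x(dy)$ for all $x$, with $\theta\ge 0$ and $\alpha_x\ge 0$. For a probability measure $\mu$ write $\mathcal T(\mu)=\int\Theta(x,\cdot)\,\mu(dx)$, and for $\epsilon>0$ let $$\tau_2(\epsilon;\mu_0)=\inf\Big\{k\in\{0,1,2,\dots\}\;:\;\Big(\int\Big|\tfrac{d\mathcal T^k(\mu_0)}{d\Pi}-1\Big|^2d\Pi\Big)^{1/2}\le\epsilon\Big\}$$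 be the $\mathcal L_2$ mixing time, where the left-hand side of the inequality is $\infty$ if $\mathcal T^k(\mu_0)\not\ll\Pi$, and $\inf\emptyset=\infty$. For measurable $\Omega\subseteq\mathcal X$ define $$\Phi_\Omega(v)=\inf\Big\{\frac{\int_S\Theta(x,S^c)\,\Pi(dx)}{\Pi(S\cap\Omega)}\;:\;S\text{ measurable},\ 0<\Pi(S\cap\Omega)\le v\Big\}$$ for $0<v\le\Pi(\Omega)/2$ (with $\inf\emptyset=\infty$), and let its truncated extension be $\tilde\Phi_\Omega(v)=\Phi_\Omega(\min\{v,\Pi(\Omega)/2\})$ for $v>0$. Then for every $\epsilon>0$, every probability measure $\mu_0$ that is $\beta$-warm, i.e. $\sup_{S}\mu_0(S)/\Pi(S)\le\beta$ over measurable $S$ (with $0/0=0$), and every measurable $\Omega$ with $\Pi(\Omega)\ge 1-\frac{\epsilon^2}{3\beta^2}$, $$\tau_2(\epsilon;\mu_0)\;\le\;\int_{4/\beta}^{8/\epsilon^2}\frac{8\,dv}{\zeta\,v\,\tilde\Phi_\Omega(v)^2},$$ where the right-hand side may be $+\infty$ (with $1/0=\infty$ and $1/\infty=0$) and is understood as $0$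 if $8/\epsilon^2\le 4/\beta$. -/

import Mathlib

open MeasureTheory ProbabilityTheory
open scoped ENNReal

namespace ConductanceMixing

variable {X : Type*} [MeasurableSpace X]

/-- The transition operator `μ ↦ 𝒯(μ)` of the chain with transition kernel `κ`:
`𝒯(μ)(A) = ∫ κ(x, A) μ(dx)`. -/
noncomputable def transitionOp (κ : Kernel X X) (μ : Measure X) : Measure X :=
  μ.bind κ

/-- Smooth chain assumption with respect to the reference measure `ref` (the measure `dy`):
`κ(x, dy) = θ(x, y) dy + α_x δ_x(dy)` with `θ ≥ 0`. -/
def IsSmoothChain (ref : Measure X) (κ : Kernel X X) : Prop :=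
  ∃ (θ : X → X → ℝ≥0∞) (α : X → ℝ≥0∞), (∀ x, Measurable (θ x)) ∧
    ∀ x, κ x = ref.withDensity (θ x) + α x • Measure.dirac x

/-- `ζ`-lazy chain: at each step the chain is forced to stay where it is with probability `ζ`,
and otherwise moves according to some Markov kernel `η`. -/
def IsLazy (ζ : ℝ) (κ : Kernel X X) : Prop :=
  ∃ η : Kernel X X, IsMarkovKernel η ∧
    ∀ x, κ x = ENNReal.ofReal ζ • Measure.dirac x + ENNReal.ofReal (1 - ζ) • η x

/-- `μ₀` is `β`-warm with respect to `π`: `sup_S μ₀(S) / π(S) ≤ β`, over measurable `S`. In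
`ℝ≥0∞` one has `0 / 0 = 0`, and `c / 0 = ∞` for `c > 0`. -/
def IsWarm (β : ℝ) (π μ₀ : Measure X) : Prop :=
  ⨆ (S : Set X) (_ : MeasurableSet S), μ₀ S / π S ≤ ENNReal.ofReal β

open Classical in
/-- The `L_p`-divergence `(∫ |dQ/dπ - 1| ^ p dπ) ^ (1 / p)`, and `∞` if `Q` is not absolutely
continuous with respect to `π`. If `Q` and `π` have densities `q` and `r > 0` with respect to a
common measure, then `dQ/dπ = q / r`. -/
noncomputable def lpDivergence (p : ℝ) (Q π : Measure X) : ℝ≥0∞ :=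
  if Q ≪ π then
    (∫⁻ x, ENNReal.ofReal (|(Q.rnDeriv π x).toReal - 1| ^ p) ∂π) ^ (1 / p)
  else ∞

/-- The `L_p` mixing time `inf {k ∈ ℕ | d_p(𝒯^k(μ₀), π) ≤ ε}`, equal to `∞` if there is no
such `k`. -/
noncomputable def mixingTime (p : ℝ) (κ : Kernel X X) (π μ₀ : Measure X) (ε : ℝ) : ℕ∞ :=
  ⨅ (k : ℕ) (_ : lpDivergence p ((transitionOp κ)^[k] μ₀) π ≤ ENNReal.ofReal ε), (k : ℕ∞)

/-- The stationary flow `φ(S) = ∫_S κ(x, Sᶜ) π(dx)`. -/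
noncomputable def flow (κ : Kernel X X) (π : Measure X) (S : Set X) : ℝ≥0∞ :=
  ∫⁻ x in S, κ x Sᶜ ∂π

/-- The `Ω`-restricted conductance profile
`Φ_Ω(v) = inf {φ(S) / π(S ∩ Ω) | S measurable, 0 < π(S ∩ Ω) ≤ v}` for `0 < v ≤ π(Ω) / 2`.
The infimum of the empty set is `∞`. -/
noncomputable def conductanceProfile (κ : Kernel X X) (π : Measure X) (Ω : Set X) (v : ℝ) :
    ℝ≥0∞ :=
  ⨅ (S : Set X) (_ : MeasurableSet S) (_ : 0 < π (S ∩ Ω)) (_ : π (S ∩ Ω) ≤ ENNReal.ofReal v),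
    flow κ π S / π (S ∩ Ω)

/-- The truncated extension of `Φ_Ω` to all `v > 0`: it is `Φ_Ω(v)` for `v ≤ π(Ω) / 2` and
`Φ_Ω(π(Ω) / 2)` for `v ≥ π(Ω) / 2`. -/
noncomputable def truncatedProfile (κ : Kernel X X) (π : Measure X) (Ω : Set X) (v : ℝ) :
    ℝ≥0∞ :=
  if v ≤ π.real Ω / 2 then conductanceProfile κ π Ω v
  else conductanceProfile κ π Ω (π.real Ω / 2)

end ConductanceMixing

/-!
Let `h_n` be the density of the chain at time `n` with respect to `π`. By reversibility,
`h_{n+1}(x) = ∫ h_n(y) κ(x, dy)`, so warmness `0 ≤ h_n ≤ β` is preserved, and the squared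
`L₂`-divergence is the variance `V_n = ∫ h_n² dπ - 1`. The argument compares the decay of `V_n` with
a differential inequality driven by the conductance profile.

* Dissipation (`integral_sq_average_le`). Laziness gives `V_{n+1} ≤ V_n - ζ D(h_n)` with
  `D(h) = ∬ (h(x) - h(y))² κ(x, dy) π(dx)`.
* Cheeger inequality (`conductanceProfile_mul_integral_sq_le`). If the support of `f ≥ 0` has
  mass at most `v` in `Ω`, the coarea formula for `f²` and the Cauchy–Schwarz inequality bound
  `Φ_Ω(v) ∫_Ω f² dπ` by the energy and the norm of `f`.
* Energy bound (`sq_truncatedProfile_mul_le`). While `V = V_n > ε²`, the part of `Ωᶜ` in any squared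
  norm is at most `β² π(Ωᶜ) ≤ ε²/3 < V/3`. If `6/V ≤ π(Ω)/2`, the Cheeger inequality is applied to
  `(h - V/6)⁺`, otherwise to the positive and negative parts of `h - m` with `m` a median of `h`
  on `Ω`. Both give `6 D(h) ≥ Φ̃_Ω(6/V)² V`.
* Comparison (`natCast_le_setLIntegral_Ioc`). Hence `V_{n+1} ≤ V_n (1 - ζ Φ̃_Ω(6/V_n)² / 6)`. In the
  variable `v = 6/V` every step sweeps an interval on which the integrand has integral at least `1`,
  starting from `6/V_0 ≥ 4/β`; if the profile vanishes at some `6/V_n`, the integral is infinite.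
  The final step, which crosses the level `ε²`, is paid for by the interval from `6/ε²` to `8/ε²`:
  the energy bound makes `Φ̃_Ω` finite there, and a finite profile is at most `1`
  (`conductanceProfile_le_one`).
-/

namespace ConductanceMixing

section
variable {X : Type*} [MeasurableSpace X]

/-! ### The averaging operator on densities and its energy dissipation -/

/-- The averaging operator `h ↦ (x ↦ ∫ h(y) κ(x, dy))`. For a reversible chain it is the action of
one transition on densities with respect to `π`. -/
noncomputable def average (κ : Kernel X X) (h : X → ℝ) (x : X) : ℝ := ∫ y, h y ∂(κ x)

/-- The quadratic form `∬ (f(x) - f(y))² κ(x, dy) π(dx)`, without the customary factor `1/2`; thus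
it is twice the Dirichlet form of the chain. -/
noncomputable def dirichletEnergy (κ : Kernel X X) (π : Measure X) (f : X → ℝ) : ℝ :=
  ∫ p, (f p.1 - f p.2) ^ 2 ∂(π ⊗ₘ κ)

variable {κ : Kernel X X} {π : Measure X} {f h : X → ℝ} {B : ℝ}

lemma integrable_of_bounds {Y : Type*} [MeasurableSpace Y] {μ : Measure Y} [IsFiniteMeasure μ]
    {f : Y → ℝ} (hf : Measurable f) (a b : ℝ) (hb : ∀ y, f y ∈ Set.Icc a b) :
    Integrable f μ :=
  Integrable.of_mem_Icc a b hf.aemeasurable (Filter.Eventually.of_forall hb)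

lemma measurable_average [IsMarkovKernel κ] (hm : Measurable h) : Measurable (average κ h) :=
  (StronglyMeasurable.integral_kernel_prod_right'
    (hm.comp measurable_snd).stronglyMeasurable).measurable

lemma average_mem_Icc [IsMarkovKernel κ] (hm : Measurable h) (hb : ∀ x, h x ∈ Set.Icc 0 B)
    (x : X) : average κ h x ∈ Set.Icc 0 B := by
  refine ⟨integral_nonneg fun y ↦ (hb y).1, ?_⟩
  calc ∫ y, h y ∂(κ x) ≤ ∫ _, B ∂(κ x) :=
        integral_mono (integrable_of_bounds hm 0 B hb) (integrable_const B) fun y ↦ (hb y).2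
    _ = B := by simp

/-- Detailed balance, with one of the two sets replaced by a nonnegative function. -/
lemma lintegral_mul_kernel_eq [IsProbabilityMeasure π] [IsMarkovKernel κ]
    (hrev : Kernel.IsReversible κ π) {A : Set X} (hA : MeasurableSet A) {g : X → ℝ≥0∞}
    (hg : Measurable g) :
    ∫⁻ x, g x * κ x A ∂π = ∫⁻ x in A, ∫⁻ y, g y ∂(κ x) ∂π := by
  refine Measurable.ennreal_induction
    (motive := fun g ↦ ∫⁻ x, g x * κ x A ∂π = ∫⁻ x in A, ∫⁻ y, g y ∂(κ x) ∂π) ?_ ?_ ?_ hg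
  · intro c s hs
    have h1 : ∀ x, s.indicator (fun _ ↦ c) x * κ x A = s.indicator (fun x ↦ c * κ x A) x := by
      intro x
      by_cases hx : x ∈ s <;> simp [hx]
    simp_rw [h1, lintegral_indicator hs, lintegral_const, Measure.restrict_apply_univ]
    rw [lintegral_const_mul _ (κ.measurable_coe hA), lintegral_const_mul _ (κ.measurable_coe hs),
      hrev hs hA]
  · intro f g _ hf _ hf' hg'
    simp only [Pi.add_apply, add_mul]
    simp_rw [lintegral_add_left hf]
    rw [lintegral_add_left (f := fun x ↦ f x * κ x A) (hf.mul (κ.measurable_coe hA)), hf', hg',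
      ← lintegral_add_left hf.lintegral_kernel]
  · intro f hf hmono hf'
    simp only [ENNReal.iSup_mul]
    rw [lintegral_iSup (f := fun n x ↦ f n x * κ x A) (fun n ↦ (hf n).mul (κ.measurable_coe hA))
      (fun i j hij x ↦ by dsimp; gcongr; exact hmono hij x)]
    simp_rw [hf', lintegral_iSup hf hmono]
    rw [← lintegral_iSup (fun n ↦ (hf n).lintegral_kernel)
      (fun i j hij x ↦ lintegral_mono (hmono hij))]

/-- One transition of a reversible chain replaces the density by its average. -/
lemma transitionOp_withDensity [IsProbabilityMeasure π] [IsMarkovKernel κ]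
    (hrev : Kernel.IsReversible κ π) (hm : Measurable h) (hb : ∀ x, h x ∈ Set.Icc 0 B) :
    transitionOp κ (π.withDensity fun x ↦ ENNReal.ofReal (h x)) =
      π.withDensity fun x ↦ ENNReal.ofReal (average κ h x) := by
  ext A hA
  rw [transitionOp, Measure.bind_apply hA (Kernel.aemeasurable _),
    lintegral_withDensity_eq_lintegral_mul _ hm.ennreal_ofReal (κ.measurable_coe hA),
    withDensity_apply _ hA]
  refine (lintegral_mul_kernel_eq hrev hA hm.ennreal_ofReal).trans (lintegral_congr fun x ↦ ?_)
  rw [average, ofReal_integral_eq_lintegral_ofReal (integrable_of_bounds hm 0 B hb)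
    (Filter.Eventually.of_forall fun y ↦ (hb y).1)]

lemma integral_average [IsProbabilityMeasure π] [IsMarkovKernel κ]
    (hinv : Kernel.Invariant κ π) (hm : Measurable h) (hb : ∀ x, h x ∈ Set.Icc 0 B) :
    ∫ x, average κ h x ∂π = ∫ x, h x ∂π := by
  have hi : Integrable (fun p : X × X ↦ h p.2) (π ⊗ₘ κ) :=
    integrable_of_bounds (hm.comp measurable_snd) 0 B fun p ↦ hb p.2
  have h1 : ∫ p, h p.2 ∂(π ⊗ₘ κ) = ∫ x, average κ h x ∂π := Measure.integral_compProd hi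
  have h2 : (π ⊗ₘ κ).map Prod.snd = π := by
    have := Measure.snd_compProd π κ
    rwa [hinv.def] at this
  rw [← h1]
  conv_rhs => rw [← h2]
  rw [integral_map measurable_snd.aemeasurable hm.aestronglyMeasurable]

lemma sq_mem_Icc {Y : Type*} {h : Y → ℝ} {B : ℝ} (hb : ∀ x, h x ∈ Set.Icc 0 B) (x : Y) :
    h x ^ 2 ∈ Set.Icc 0 (B ^ 2) :=
  ⟨sq_nonneg _, pow_le_pow_left₀ (hb x).1 (hb x).2 2⟩

lemma integrable_sq_sub [IsProbabilityMeasure π] [IsMarkovKernel κ] (hm : Measurable h)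
    (hb : ∀ x, h x ∈ Set.Icc 0 B) :
    Integrable (fun p : X × X ↦ (h p.1 - h p.2) ^ 2) (π ⊗ₘ κ) := by
  refine integrable_of_bounds (((hm.comp measurable_fst).sub
    (hm.comp measurable_snd)).pow_const 2) 0 (B ^ 2) fun p ↦ ⟨sq_nonneg _, ?_⟩
  have h1 := hb p.1
  have h2 := hb p.2
  exact sq_le_sq' (by linarith [h1.1, h2.2]) (by linarith [h1.2, h2.1])

/-- Jensen's inequality sharpened by laziness. The holding part of `κ(x, ·)` has mass `ζ`, and
Jensen's inequality is applied only to the moving part, which leaves a gain of `ζ` times the mean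
squared increment at `x`. -/
lemma sq_average_le [IsMarkovKernel κ] {ζ : ℝ} (hζ0 : 0 ≤ ζ) (hζ1 : ζ ≤ 1) (hlazy : IsLazy ζ κ)
    (hm : Measurable h) (hb : ∀ x, h x ∈ Set.Icc 0 B) (x : X) :
    average κ h x ^ 2 ≤
      average κ (fun y ↦ h y ^ 2) x - ζ * ∫ y, (h x - h y) ^ 2 ∂(κ x) := by
  obtain ⟨η, hη, hκ⟩ := hlazy
  have hb2 := sq_mem_Icc hb
  have int1 : ∀ (μ : Measure X) [IsFiniteMeasure μ], Integrable h μ := fun μ _ ↦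
    integrable_of_bounds hm 0 B hb
  have int2 : ∀ (μ : Measure X) [IsFiniteMeasure μ], Integrable (fun y ↦ h y ^ 2) μ := fun μ _ ↦
    integrable_of_bounds (hm.pow_const 2) 0 (B ^ 2) hb2
  have key : ∀ f : X → ℝ, Measurable f → Integrable f (η x) →
      ∫ y, f y ∂(κ x) = ζ * f x + (1 - ζ) * ∫ y, f y ∂(η x) := by
    intro f hf hi
    have hd : Integrable f (Measure.dirac x) := by
      refine integrable_dirac' hf.stronglyMeasurable ?_
      simp
    rw [hκ x, integral_add_measure (hd.smul_measure ENNReal.ofReal_ne_top)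
      (hi.smul_measure ENNReal.ofReal_ne_top), integral_smul_measure, integral_smul_measure,
      integral_dirac' _ _ hf.stronglyMeasurable, ENNReal.toReal_ofReal hζ0,
      ENNReal.toReal_ofReal (by linarith)]
    rfl
  have e3 : ∫ y, (h x - h y) ^ 2 ∂(κ x) =
      h x ^ 2 - 2 * h x * average κ h x + average κ (fun y ↦ h y ^ 2) x := by
    have : ∀ y, (h x - h y) ^ 2 = h x ^ 2 - 2 * h x * h y + h y ^ 2 := fun y ↦ by ring
    simp_rw [this]
    have i12 : Integrable (fun y ↦ h x ^ 2 - 2 * h x * h y) (κ x) :=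
      (integrable_const _).sub ((int1 _).const_mul _)
    rw [integral_add i12 (int2 _),
      integral_sub (integrable_const _) ((int1 _).const_mul _), integral_const_mul]
    simp [average]
  have e1 := key h hm (int1 _)
  have e2 := key _ (hm.pow_const 2) (int2 _)
  have jensen : (∫ y, h y ∂(η x)) ^ 2 ≤ ∫ y, h y ^ 2 ∂(η x) := by
    have h0 : 0 ≤ ∫ y, (h y - ∫ z, h z ∂(η x)) ^ 2 ∂(η x) := integral_nonneg fun y ↦ sq_nonneg _
    set g := ∫ z, h z ∂(η x) with hg
    have : ∀ y, (h y - g) ^ 2 = h y ^ 2 - 2 * g * h y + g ^ 2 := fun y ↦ by ring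
    simp_rw [this] at h0
    have i12 : Integrable (fun y ↦ h y ^ 2 - 2 * g * h y) (η x) :=
      (int2 _).sub ((int1 _).const_mul _)
    rw [integral_add i12 (integrable_const _),
      integral_sub (int2 _) ((int1 _).const_mul _), integral_const_mul, ← hg] at h0
    simp at h0
    linarith
  rw [e3]
  change (∫ y, h y ∂(κ x)) ^ 2 ≤ (∫ y, h y ^ 2 ∂(κ x)) - ζ * (h x ^ 2 -
    2 * h x * (∫ y, h y ∂(κ x)) + ∫ y, h y ^ 2 ∂(κ x))
  rw [e1, e2]
  nlinarith [mul_le_mul_of_nonneg_left jensen (sq_nonneg (1 - ζ))]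

/-- Integrated over the invariant measure, `sq_average_le` says that one step of a lazy chain
dissipates at least `ζ` times the energy. -/
lemma integral_sq_average_le [IsProbabilityMeasure π] [IsMarkovKernel κ]
    (hinv : Kernel.Invariant κ π) {ζ : ℝ} (hζ0 : 0 ≤ ζ) (hζ1 : ζ ≤ 1) (hlazy : IsLazy ζ κ)
    (hm : Measurable h) (hb : ∀ x, h x ∈ Set.Icc 0 B) :
    ∫ x, average κ h x ^ 2 ∂π ≤ ∫ x, h x ^ 2 ∂π - ζ * dirichletEnergy κ π h := by
  have hb2 := sq_mem_Icc hb
  have hD := integrable_sq_sub (κ := κ) (π := π) hm hb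
  have hD' : Integrable (fun x ↦ ∫ y, (h x - h y) ^ 2 ∂(κ x)) π := by
    simpa using ((Measure.integrable_compProd_iff hD.1).1 hD).2
  rw [dirichletEnergy, Measure.integral_compProd hD,
    ← integral_average hinv (hm.pow_const 2) hb2, ← integral_const_mul,
    ← integral_sub]
  · refine integral_mono ?_ ?_ fun x ↦ sq_average_le hζ0 hζ1 hlazy hm hb x
    · refine integrable_of_bounds ((measurable_average hm).pow_const 2) 0 (B ^ 2) fun x ↦ ?_
      have := average_mem_Icc (κ := κ) hm hb x
      exact ⟨sq_nonneg _, pow_le_pow_left₀ this.1 this.2 2⟩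
    · exact (integrable_of_bounds (measurable_average (hm.pow_const 2)) 0 (B ^ 2)
        (average_mem_Icc (hm.pow_const 2) hb2)).sub (hD'.const_mul ζ)
  · exact integrable_of_bounds (measurable_average (hm.pow_const 2)) 0 (B ^ 2)
        (average_mem_Icc (hm.pow_const 2) hb2)
  · exact hD'.const_mul ζ

/-! ### A Cheeger inequality for functions with small support in `Ω` -/

/-- The case `π (S ∩ Ω) = 0` is included, because `∞ * 0 = 0`. -/
lemma conductanceProfile_mul_le_flow {Ω S : Set X} {v : ℝ} (hS : MeasurableSet S)
    (hv : π (S ∩ Ω) ≤ ENNReal.ofReal v) :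
    conductanceProfile κ π Ω v * π (S ∩ Ω) ≤ flow κ π S := by
  rcases eq_or_ne (π (S ∩ Ω)) 0 with h0 | h0
  · simp [h0]
  · refine ENNReal.mul_le_of_le_div ?_
    exact iInf_le_of_le S (iInf_le_of_le hS (iInf_le_of_le (pos_iff_ne_zero.2 h0)
      (iInf_le_of_le hv le_rfl)))

/-- Coarea formula: the flows out of the superlevel sets of `g` integrate to the total decrease of
`g` along one step of the stationary chain. -/
lemma lintegral_flow_superlevel [IsProbabilityMeasure π] [IsMarkovKernel κ]
    {g : X → ℝ} (hm : Measurable g) (h0 : ∀ x, 0 ≤ g x) :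
    ∫⁻ t in Set.Ioi (0 : ℝ), flow κ π {x | t < g x} =
      ∫⁻ p, ENNReal.ofReal (g p.1 - g p.2) ∂(π ⊗ₘ κ) := by
  have hE : MeasurableSet {q : ℝ × (X × X) | q.1 < g q.2.1 ∧ g q.2.2 ≤ q.1} := by
    refine (measurableSet_lt measurable_fst (hm.comp (measurable_fst.comp measurable_snd))).inter
      (measurableSet_le (hm.comp (measurable_snd.comp measurable_snd)) measurable_fst)
  have h1 : ∀ t : ℝ, flow κ π {x | t < g x} =
      ∫⁻ p, {q : ℝ × (X × X) | q.1 < g q.2.1 ∧ g q.2.2 ≤ q.1}.indicator 1 (t, p)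
        ∂(π ⊗ₘ κ) := by
    intro t
    have hS : MeasurableSet {x | t < g x} := measurableSet_lt measurable_const hm
    have : ∀ p : X × X, {q : ℝ × (X × X) | q.1 < g q.2.1 ∧ g q.2.2 ≤ q.1}.indicator
        (1 : ℝ × (X × X) → ℝ≥0∞) (t, p) =
        ({x | t < g x} ×ˢ {x | t < g x}ᶜ).indicator (1 : X × X → ℝ≥0∞) p := by
      intro p
      simp [Set.indicator_apply]
    simp_rw [this]
    rw [lintegral_indicator_one (hS.prod hS.compl), Measure.compProd_apply_prod hS hS.compl, flow]
  simp_rw [h1]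
  rw [lintegral_lintegral_swap (f := fun (t : ℝ) (p : X × X) ↦
    {q : ℝ × (X × X) | q.1 < g q.2.1 ∧ g q.2.2 ≤ q.1}.indicator (1 : ℝ × (X × X) → ℝ≥0∞) (t, p))
    ((measurable_one.indicator hE).aemeasurable)]
  refine lintegral_congr fun p ↦ ?_
  have : ∀ t : ℝ, {q : ℝ × (X × X) | q.1 < g q.2.1 ∧ g q.2.2 ≤ q.1}.indicator
      (1 : ℝ × (X × X) → ℝ≥0∞) (t, p) = (Set.Ico (g p.2) (g p.1)).indicator 1 t := by
    intro t
    simp [Set.indicator_apply, and_comm]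
  simp_rw [this]
  rw [lintegral_indicator_one measurableSet_Ico, Measure.restrict_apply measurableSet_Ico,
    ← Real.volume_Ico]
  refine measure_congr ?_
  have : (Set.Ico (g p.2) (g p.1) : Set ℝ) ∩ Set.Ici 0 = Set.Ico (g p.2) (g p.1) :=
    Set.inter_eq_left.2 fun t ht ↦ (h0 _).trans ht.1
  conv_rhs => rw [← this]
  exact (Filter.EventuallyEq.refl _ _).inter Ioi_ae_eq_Ici

/-- Every superlevel set of `f²` at a positive level lies in the support of `f`, so it is an
admissible competitor in the profile; integrating over levels gives the bound. -/
lemma conductanceProfile_mul_lintegral_sq_le [IsProbabilityMeasure π] [IsMarkovKernel κ]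
    {Ω : Set X} {v : ℝ} (hm : Measurable f) (hf : ∀ x, 0 ≤ f x)
    (hv : π ({x | 0 < f x} ∩ Ω) ≤ ENNReal.ofReal v) :
    conductanceProfile κ π Ω v * ∫⁻ x in Ω, ENNReal.ofReal (f x ^ 2) ∂π ≤
      ∫⁻ p, ENNReal.ofReal (f p.1 ^ 2 - f p.2 ^ 2) ∂(π ⊗ₘ κ) := by
  have hm2 := hm.pow_const 2
  have hanti : Antitone fun t : ℝ ↦ (π.restrict Ω) {x | t < f x ^ 2} := fun s t hst ↦
    measure_mono fun x (hx : t < f x ^ 2) ↦ hst.trans_lt hx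
  rw [lintegral_eq_lintegral_meas_lt _ (Filter.Eventually.of_forall fun x ↦ sq_nonneg (f x))
    hm2.aemeasurable, ← lintegral_const_mul _ hanti.measurable,
    ← lintegral_flow_superlevel hm2 fun x ↦ sq_nonneg _]
  refine setLIntegral_mono' measurableSet_Ioi fun t (ht : 0 < t) ↦ ?_
  have hS : MeasurableSet {x | t < f x ^ 2} := measurableSet_lt measurable_const hm2
  rw [Measure.restrict_apply hS]
  refine conductanceProfile_mul_le_flow hS (le_trans (measure_mono ?_) hv)
  rintro x ⟨hx, hxΩ⟩
  refine ⟨(hf x).lt_of_ne' fun h0 ↦ ?_, hxΩ⟩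
  simp only [Set.mem_ofPred_eq, h0] at hx
  norm_num at hx
  linarith

/-- A Cauchy–Schwarz inequality with a free parameter `c`. Linearity of the right-hand side
in the energy and in the squared norm allows the bounds for two functions to be added. -/
lemma lintegral_ofReal_sq_sub_sq_le [IsProbabilityMeasure π] [IsMarkovKernel κ]
    (hinv : Kernel.Invariant κ π) (hm : Measurable f) (hb : ∀ x, f x ∈ Set.Icc 0 B)
    {c : ℝ} (hc : 0 < c) :
    ∫⁻ p, ENNReal.ofReal (f p.1 ^ 2 - f p.2 ^ 2) ∂(π ⊗ₘ κ) ≤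
      ENNReal.ofReal (c * dirichletEnergy κ π f / 4 + (∫ x, f x ^ 2 ∂π) / c) := by
  have hb2 := sq_mem_Icc hb
  have hm1 : Measurable fun p : X × X ↦ f p.1 := hm.comp measurable_fst
  have hm2 : Measurable fun p : X × X ↦ f p.2 := hm.comp measurable_snd
  have i1 : Integrable (fun p : X × X ↦ f p.1 ^ 2) (π ⊗ₘ κ) :=
    integrable_of_bounds (hm1.pow_const 2) 0 (B ^ 2) fun p ↦ hb2 p.1
  have i2 : Integrable (fun p : X × X ↦ f p.2 ^ 2) (π ⊗ₘ κ) :=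
    integrable_of_bounds (hm2.pow_const 2) 0 (B ^ 2) fun p ↦ hb2 p.2
  have iD := integrable_sq_sub (κ := κ) (π := π) hm hb
  have e1 : ∫ p, f p.1 ^ 2 ∂(π ⊗ₘ κ) = ∫ x, f x ^ 2 ∂π := by
    rw [Measure.integral_compProd i1]; simp
  have e2 : ∫ p, f p.2 ^ 2 ∂(π ⊗ₘ κ) = ∫ x, f x ^ 2 ∂π := by
    rw [Measure.integral_compProd i2]
    exact integral_average hinv (hm.pow_const 2) hb2
  -- `(a² - b²)⁺` is half of `|a² - b²| + (a² - b²)`, and the second term integrates to zero by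
  -- stationarity. With `|a² - b²| ≤ c (a - b)² / 2 + (a + b)² / (2c)` and `(a + b)² ≤ 2a² + 2b²`
  -- this leads to the majorant `G`.
  set G : X × X → ℝ := fun p ↦
    c / 4 * (f p.1 - f p.2) ^ 2 + (1 / 2 + 1 / (2 * c)) * f p.1 ^ 2 +
      (1 / (2 * c) - 1 / 2) * f p.2 ^ 2 with hG
  have hle : ∀ p : X × X, max (f p.1 ^ 2 - f p.2 ^ 2) 0 ≤ G p := by
    intro p
    have amgm : ∀ s : ℝ, s ^ 2 = 1 → 0 ≤ c / 4 * (f p.1 - f p.2) ^ 2 +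
        1 / (4 * c) * (f p.1 + f p.2) ^ 2 - s / 2 * (f p.1 ^ 2 - f p.2 ^ 2) := by
      intro s hs
      have : c / 4 * (f p.1 - f p.2) ^ 2 +
        1 / (4 * c) * (f p.1 + f p.2) ^ 2 - s / 2 * (f p.1 ^ 2 - f p.2 ^ 2) =
        1 / (4 * c) * (c * (f p.1 - f p.2) - s * (f p.1 + f p.2)) ^ 2 := by
        field_simp
        linear_combination (-2 * (f p.1 + f p.2) ^ 2) * hs
      rw [this]; positivity
    have hpar : G p = c / 4 * (f p.1 - f p.2) ^ 2 + 1 / (4 * c) * (f p.1 + f p.2) ^ 2 +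
        1 / 2 * (f p.1 ^ 2 - f p.2 ^ 2) + 1 / (4 * c) * (f p.1 - f p.2) ^ 2 := by
      simp only [hG]; field_simp; ring
    have hnn : 0 ≤ 1 / (4 * c) * (f p.1 - f p.2) ^ 2 := by positivity
    refine max_le ?_ ?_
    · linarith [amgm 1 (by norm_num)]
    · linarith [amgm (-1) (by norm_num)]
  have iG : Integrable G (π ⊗ₘ κ) :=
    ((iD.const_mul _).add (i1.const_mul _)).add (i2.const_mul _)
  calc ∫⁻ p, ENNReal.ofReal (f p.1 ^ 2 - f p.2 ^ 2) ∂(π ⊗ₘ κ)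
      ≤ ∫⁻ p, ENNReal.ofReal (G p) ∂(π ⊗ₘ κ) :=
        lintegral_mono fun p ↦ ENNReal.ofReal_le_ofReal ((le_max_left _ _).trans (hle p))
    _ = ENNReal.ofReal (∫ p, G p ∂(π ⊗ₘ κ)) :=
        (ofReal_integral_eq_lintegral_ofReal iG
          (Filter.Eventually.of_forall fun p ↦ (le_max_right _ _).trans (hle p))).symm
    _ = _ := by
        congr 1
        simp only [hG]
        have i12 : Integrable (fun p : X × X ↦ c / 4 * (f p.1 - f p.2) ^ 2 +
            (1 / 2 + 1 / (2 * c)) * f p.1 ^ 2) (π ⊗ₘ κ) :=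
          (iD.const_mul _).add (i1.const_mul _)
        rw [integral_add i12 (i2.const_mul _), integral_add (iD.const_mul _) (i1.const_mul _),
          integral_const_mul, integral_const_mul, integral_const_mul, e1, e2, dirichletEnergy]
        ring

/-- The Cheeger inequality, in a form linearized by the parameter `c`. -/
lemma conductanceProfile_mul_integral_sq_le [IsProbabilityMeasure π] [IsMarkovKernel κ]
    (hinv : Kernel.Invariant κ π) {Ω : Set X} {v : ℝ}
    (hm : Measurable f) (hb : ∀ x, f x ∈ Set.Icc 0 B)
    (hv : π ({x | 0 < f x} ∩ Ω) ≤ ENNReal.ofReal v) {c : ℝ} (hc : 0 < c) :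
    conductanceProfile κ π Ω v * ENNReal.ofReal (∫ x in Ω, f x ^ 2 ∂π) ≤
      ENNReal.ofReal (c * dirichletEnergy κ π f / 4 + (∫ x, f x ^ 2 ∂π) / c) := by
  rw [ofReal_integral_eq_lintegral_ofReal]
  · exact (conductanceProfile_mul_lintegral_sq_le hm (fun x ↦ (hb x).1) hv).trans
      (lintegral_ofReal_sq_sub_sq_le hinv hm hb hc)
  · exact integrable_of_bounds (hm.pow_const 2) 0 (B ^ 2) (sq_mem_Icc hb)
  · exact Filter.Eventually.of_forall fun x ↦ sq_nonneg _

/-! ### Energy lower bound from the restricted profile -/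

/-- Optimization of the parameter `c` in the linearized Cheeger inequality. Here `A` stands for
the squared norm of the test functions on the whole space and `a` for that on `Ω`; the thresholds
`2V/3` and `V/3` give `a² ≥ A V / 6`. -/
lemma sq_mul_le_of_forall_mul_ofReal_le {Φ : ℝ≥0∞} {a A D V : ℝ} (hV : 0 < V)
    (hA : 2 * V / 3 ≤ A) (ha : A - V / 3 ≤ a)
    (hΦ : ∀ c : ℝ, 0 < c → Φ * ENNReal.ofReal a ≤ ENNReal.ofReal (c * D / 4 + A / c))
    (hD : 0 ≤ D) :
    Φ ≠ ∞ ∧ Φ.toReal ^ 2 * V ≤ 6 * D := by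
  have ha0 : 0 < a := by linarith
  have hfin : Φ ≠ ∞ := by
    rintro rfl
    have := hΦ 1 one_pos
    rw [ENNReal.top_mul (by simpa using ha0)] at this
    exact ENNReal.ofReal_ne_top (top_le_iff.1 this)
  refine ⟨hfin, ?_⟩
  rcases ENNReal.toReal_nonneg (a := Φ).eq_or_lt with h0 | h0
  · rw [← h0]; linarith
  set φ := Φ.toReal with hφ
  have hA0 : 0 < A := by linarith
  -- `c = 2A / (φ a)` minimizes `c D / 4 + A / c` at `D = (φ a)² / A`, the least energy for which
  -- all the bounds hold.
  have hc : 0 < 2 * A / (φ * a) := by positivity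
  have h1 := hΦ _ hc
  rw [← ENNReal.ofReal_toReal hfin, ← hφ, ← ENNReal.ofReal_mul h0.le,
    ENNReal.ofReal_le_ofReal_iff (by positivity)] at h1
  have h2 : 2 * A / (φ * a) * D / 4 + A / (2 * A / (φ * a)) =
      A * D / (2 * (φ * a)) + φ * a / 2 := by
    field_simp
    ring
  rw [h2] at h1
  have h3 : φ * a / 2 ≤ A * D / (2 * (φ * a)) := by linarith
  rw [le_div_iff₀ (by positivity)] at h3
  have h4 : A * V / 6 ≤ a ^ 2 := by nlinarith
  have h5 : A * (φ ^ 2 * V) ≤ A * (6 * D) := by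
    nlinarith [mul_le_mul_of_nonneg_left h4 (sq_nonneg φ)]
  exact le_of_mul_le_mul_left h5 hA0

lemma integral_le_setIntegral_add [IsProbabilityMeasure π] {Ω : Set X} (hΩ : MeasurableSet Ω)
    {g : X → ℝ} (hm : Measurable g) (hb : ∀ x, g x ∈ Set.Icc 0 B) :
    ∫ x, g x ∂π ≤ ∫ x in Ω, g x ∂π + B * π.real Ωᶜ := by
  rw [← integral_add_compl hΩ (integrable_of_bounds hm 0 B hb)]
  gcongr
  calc ∫ x in Ωᶜ, g x ∂π ≤ ∫ _ in Ωᶜ, B ∂π :=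
        integral_mono (integrable_of_bounds hm 0 B hb) (integrable_const B) fun x ↦ (hb x).2
    _ = B * π.real Ωᶜ := by simp [mul_comm]

lemma dirichletEnergy_nonneg : 0 ≤ dirichletEnergy κ π f :=
  integral_nonneg fun _ ↦ sq_nonneg _

/-- Energy bound from the truncation `(h - V/6)⁺`. By Markov's inequality its support has mass at
most `6/V`, and it retains two thirds of the variance `V`. The hypothesis on `Ωᶜ` keeps the part of
the squared norm lost outside `Ω` below `V/3`. -/
lemma sq_conductanceProfile_mul_le_of_level [IsProbabilityMeasure π] [IsMarkovKernel κ]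
    (hinv : Kernel.Invariant κ π) {Ω : Set X} (hΩ : MeasurableSet Ω)
    (hm : Measurable h) (hb : ∀ x, h x ∈ Set.Icc 0 B) (h1 : ∫ x, h x ∂π = 1)
    {V : ℝ} (hV : 0 < V) (hVh : ∫ x, h x ^ 2 ∂π = V + 1)
    (hΩB : B ^ 2 * π.real Ωᶜ ≤ V / 3) :
    conductanceProfile κ π Ω (6 / V) ≠ ∞ ∧
      (conductanceProfile κ π Ω (6 / V)).toReal ^ 2 * V ≤ 6 * dirichletEnergy κ π h := by
  set f : X → ℝ := fun x ↦ max (h x - V / 6) 0 with hf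
  have hfm : Measurable f := (hm.sub_const _).max measurable_const
  have hfb : ∀ x, f x ∈ Set.Icc 0 B := fun x ↦
    ⟨le_max_right _ _, max_le (by linarith [(hb x).2]) ((hb x).1.trans (hb x).2)⟩
  have ih := integrable_of_bounds (μ := π) hm 0 B hb
  have ih2 := integrable_of_bounds (μ := π) (hm.pow_const 2) 0 _ (sq_mem_Icc hb)
  have if2 := integrable_of_bounds (μ := π) (hfm.pow_const 2) 0 _ (sq_mem_Icc hfb)
  have hA : 2 * V / 3 ≤ ∫ x, f x ^ 2 ∂π := by
    have : ∫ x, (h x ^ 2 - V / 3 * h x) ∂π ≤ ∫ x, f x ^ 2 ∂π := by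
      refine integral_mono (ih2.sub (ih.const_mul _)) if2 fun x ↦ ?_
      have h0 := (hb x).1
      simp only [hf]
      rcases le_total (h x - V / 6) 0 with hx | hx
      · rw [max_eq_right hx]; nlinarith
      · rw [max_eq_left hx]; nlinarith
    rw [integral_sub ih2 (ih.const_mul _), integral_const_mul, h1, hVh] at this
    linarith
  have hmarkov : π ({x | 0 < f x} ∩ Ω) ≤ ENNReal.ofReal (6 / V) := by
    have hmk := mul_meas_ge_le_integral_of_nonneg
      (Filter.Eventually.of_forall fun x ↦ (hb x).1) ih (V / 6)
    rw [h1] at hmk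
    refine le_trans (measure_mono (t := {x | V / 6 ≤ h x}) ?_) ?_
    · rintro x ⟨hx, -⟩
      simp only [hf, Set.mem_ofPred_eq, lt_max_iff, lt_irrefl, or_false] at hx
      exact (sub_pos.1 hx).le
    · rw [← ofReal_measureReal]
      refine ENNReal.ofReal_le_ofReal ?_
      rw [le_div_iff₀ hV]
      linarith
  have hD : dirichletEnergy κ π f ≤ dirichletEnergy κ π h := by
    refine integral_mono (integrable_sq_sub hfm hfb) (integrable_sq_sub hm hb) fun p ↦ ?_
    refine sq_le_sq.2 ?_
    have := abs_max_sub_max_le_abs (h p.1 - V / 6) (h p.2 - V / 6) 0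
    simpa [hf] using this
  have := sq_mul_le_of_forall_mul_ofReal_le hV hA
    (by linarith [integral_le_setIntegral_add (π := π) hΩ (hfm.pow_const 2) (sq_mem_Icc hfb)])
    (fun c hc ↦ conductanceProfile_mul_integral_sq_le hinv hfm hfb hmarkov hc)
    dirichletEnergy_nonneg
  exact ⟨this.1, by linarith [this.2]⟩

/-- A median of `h` with respect to the restriction of `π` to `Ω`. -/
lemma exists_median [IsFiniteMeasure π] {Ω : Set X}
    (hm : Measurable h) (hb : ∀ x, h x ∈ Set.Icc 0 B) (hB : 0 ≤ B) :
    ∃ m ∈ Set.Icc 0 B, π ({x | m < h x} ∩ Ω) ≤ ENNReal.ofReal (π.real Ω / 2) ∧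
      π ({x | h x < m} ∩ Ω) ≤ ENNReal.ofReal (π.real Ω / 2) := by
  set T : Set ℝ := {t | 0 ≤ t ∧ π ({x | t < h x} ∩ Ω) ≤ ENNReal.ofReal (π.real Ω / 2)} with hT
  have hBT : B ∈ T := by
    refine ⟨hB, ?_⟩
    have : {x | B < h x} = ∅ := Set.eq_empty_of_forall_notMem fun x hx ↦ (hb x).2.not_gt hx
    simp [this]
  have hbdd : BddBelow T := ⟨0, fun t ht ↦ ht.1⟩
  refine ⟨sInf T, ⟨le_csInf ⟨B, hBT⟩ fun t ht ↦ ht.1, csInf_le hbdd hBT⟩, ?_, ?_⟩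
  · obtain ⟨u, hu, hlim, huT⟩ := exists_seq_tendsto_sInf ⟨B, hBT⟩ hbdd
    have hU : {x | sInf T < h x} ∩ Ω ⊆ ⋃ n, {x | u n < h x} ∩ Ω := by
      rintro x ⟨hx, hxΩ⟩
      obtain ⟨n, hn⟩ := (hlim.eventually_lt_const hx).exists
      exact Set.mem_iUnion.2 ⟨n, hn, hxΩ⟩
    refine (measure_mono hU).trans ?_
    have hmono : Monotone fun n ↦ {x | u n < h x} ∩ Ω := fun i j hij x hx ↦
      ⟨(hu hij).trans_lt hx.1, hx.2⟩
    rw [hmono.measure_iUnion]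
    exact iSup_le fun n ↦ (huT n).2
  · obtain ⟨u, hu, hlt, hlim⟩ := exists_seq_strictMono_tendsto (sInf T)
    have hU : {x | h x < sInf T} ∩ Ω ⊆ ⋃ n, {x | h x ≤ u n} ∩ Ω := by
      rintro x ⟨hx, hxΩ⟩
      obtain ⟨n, hn⟩ := (hlim.eventually_const_lt hx).exists
      exact Set.mem_iUnion.2 ⟨n, le_of_lt hn, hxΩ⟩
    refine (measure_mono hU).trans ?_
    have hmono : Monotone fun n ↦ {x | h x ≤ u n} ∩ Ω := fun i j hij x hx ↦
      ⟨hx.1.trans (hu.monotone hij), hx.2⟩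
    rw [hmono.measure_iUnion]
    refine iSup_le fun n ↦ ?_
    rcases lt_or_ge (u n) 0 with h0 | h0
    · have : {x | h x ≤ u n} = ∅ :=
        Set.eq_empty_of_forall_notMem fun x hx ↦ (h0.trans_le (hb x).1).not_ge hx
      simp [this]
    · have hnT : ¬ π ({x | u n < h x} ∩ Ω) ≤ ENNReal.ofReal (π.real Ω / 2) := fun hle ↦
        (hlt n).not_ge (csInf_le hbdd ⟨h0, hle⟩)
      have hsplit := measureReal_inter_add_sdiff (μ := π) (s := Ω)
        (measurableSet_lt (measurable_const (a := u n)) hm)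
      have hset : Ω \ {x | u n < h x} = {x | h x ≤ u n} ∩ Ω := by
        ext x
        simp [and_comm]
      rw [hset, Set.inter_comm] at hsplit
      rw [← ofReal_measureReal, ENNReal.ofReal_le_ofReal_iff (by positivity)] at hnT ⊢
      linarith

/-- Energy bound from splitting `h` at a median `m` on `Ω`: both `(h - m)⁺` and `(h - m)⁻` have
support of mass at most `π(Ω)/2` in `Ω`, and `∫ (h - m)² dπ` is at least the variance `V`. -/
lemma sq_conductanceProfile_mul_le_of_median [IsProbabilityMeasure π] [IsMarkovKernel κ]
    (hinv : Kernel.Invariant κ π) {Ω : Set X} (hΩ : MeasurableSet Ω)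
    (hm : Measurable h) (hb : ∀ x, h x ∈ Set.Icc 0 B) (hB : 0 ≤ B) (h1 : ∫ x, h x ∂π = 1)
    {V : ℝ} (hV : 0 < V) (hVh : ∫ x, h x ^ 2 ∂π = V + 1)
    (hΩB : B ^ 2 * π.real Ωᶜ ≤ V / 3) :
    conductanceProfile κ π Ω (π.real Ω / 2) ≠ ∞ ∧
      (conductanceProfile κ π Ω (π.real Ω / 2)).toReal ^ 2 * V ≤
        6 * dirichletEnergy κ π h := by
  obtain ⟨m, ⟨hm0, hmB⟩, hup, hlow⟩ := exists_median (π := π) hm hb hB (Ω := Ω)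
  set f : X → ℝ := fun x ↦ max (h x - m) 0 with hf
  set g : X → ℝ := fun x ↦ max (m - h x) 0 with hg
  have hfm : Measurable f := (hm.sub_const _).max measurable_const
  have hgm : Measurable g := (measurable_const.sub hm).max measurable_const
  have hfb : ∀ x, f x ∈ Set.Icc 0 B := fun x ↦
    ⟨le_max_right _ _, max_le (by linarith [(hb x).2]) hB⟩
  have hgb : ∀ x, g x ∈ Set.Icc 0 B := fun x ↦
    ⟨le_max_right _ _, max_le (by linarith [(hb x).1]) hB⟩
  have hfg : ∀ x, f x ^ 2 + g x ^ 2 = (h x - m) ^ 2 := by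
    intro x
    simp only [hf, hg]
    rcases le_total (h x) m with hx | hx
    · rw [max_eq_right (by linarith), max_eq_left (by linarith)]; ring
    · rw [max_eq_left (by linarith), max_eq_right (by linarith)]; ring
  have ih := integrable_of_bounds (μ := π) hm 0 B hb
  have ih2 := integrable_of_bounds (μ := π) (hm.pow_const 2) 0 _ (sq_mem_Icc hb)
  have if2 := integrable_of_bounds (μ := π) (hfm.pow_const 2) 0 _ (sq_mem_Icc hfb)
  have ig2 := integrable_of_bounds (μ := π) (hgm.pow_const 2) 0 _ (sq_mem_Icc hgb)
  have hsq : ∀ x, (h x - m) ^ 2 ∈ Set.Icc 0 (B ^ 2) := fun x ↦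
    ⟨sq_nonneg _, sq_le_sq' (by linarith [(hb x).1]) (by linarith [(hb x).2])⟩
  have hA : ∫ x, f x ^ 2 ∂π + ∫ x, g x ^ 2 ∂π = ∫ x, (h x - m) ^ 2 ∂π := by
    rw [← integral_add if2 ig2]
    simp_rw [hfg]
  have ha : ∫ x in Ω, f x ^ 2 ∂π + ∫ x in Ω, g x ^ 2 ∂π = ∫ x in Ω, (h x - m) ^ 2 ∂π := by
    rw [← integral_add if2.integrableOn ig2.integrableOn]
    simp_rw [hfg]
  have hAV : V ≤ ∫ x, (h x - m) ^ 2 ∂π := by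
    have e : ∀ x, (h x - m) ^ 2 = h x ^ 2 - 2 * m * h x + m ^ 2 := fun x ↦ by ring
    have i12 : Integrable (fun x ↦ h x ^ 2 - 2 * m * h x) π := ih2.sub (ih.const_mul _)
    simp_rw [e]
    rw [integral_add i12 (integrable_const _), integral_sub ih2 (ih.const_mul _),
      integral_const_mul, h1, hVh, integral_const, probReal_univ, one_smul]
    nlinarith [sq_nonneg (m - 1)]
  have hD : dirichletEnergy κ π f + dirichletEnergy κ π g ≤ dirichletEnergy κ π h := by
    rw [dirichletEnergy, dirichletEnergy,
      ← integral_add (integrable_sq_sub hfm hfb) (integrable_sq_sub hgm hgb)]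
    refine integral_mono ((integrable_sq_sub hfm hfb).add (integrable_sq_sub hgm hgb))
      (integrable_sq_sub hm hb) fun p ↦ ?_
    have e : ∀ x, h x = m + f x - g x := by
      intro x
      simp only [hf, hg]
      rcases le_total (h x) m with hx | hx
      · rw [max_eq_right (by linarith), max_eq_left (by linarith)]; ring
      · rw [max_eq_left (by linarith), max_eq_right (by linarith)]; ring
    have e0 : ∀ x, f x * g x = 0 := by
      intro x
      simp only [hf, hg]
      rcases le_total (h x) m with hx | hx
      · rw [max_eq_right (by linarith), zero_mul]
      · rw [max_eq_right (b := (0 : ℝ)) (a := m - h x) (by linarith), mul_zero]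
    have n1 := mul_nonneg (hfb p.1).1 (hgb p.2).1
    have n2 := mul_nonneg (hfb p.2).1 (hgb p.1).1
    dsimp only
    rw [e p.1, e p.2]
    nlinarith [e0 p.1, e0 p.2]
  have hΦ : ∀ c : ℝ, 0 < c → conductanceProfile κ π Ω (π.real Ω / 2) *
      ENNReal.ofReal (∫ x in Ω, f x ^ 2 ∂π + ∫ x in Ω, g x ^ 2 ∂π) ≤
      ENNReal.ofReal (c * (dirichletEnergy κ π f + dirichletEnergy κ π g) / 4 +
        (∫ x, f x ^ 2 ∂π + ∫ x, g x ^ 2 ∂π) / c) := by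
    intro c hc
    have hvf : π ({x | 0 < f x} ∩ Ω) ≤ ENNReal.ofReal (π.real Ω / 2) := by simpa [hf] using hup
    have hvg : π ({x | 0 < g x} ∩ Ω) ≤ ENNReal.ofReal (π.real Ω / 2) := by simpa [hg] using hlow
    rw [ENNReal.ofReal_add (integral_nonneg fun _ ↦ sq_nonneg _)
      (integral_nonneg fun _ ↦ sq_nonneg _), mul_add]
    refine (add_le_add (conductanceProfile_mul_integral_sq_le hinv hfm hfb hvf hc)
      (conductanceProfile_mul_integral_sq_le hinv hgm hgb hvg hc)).trans ?_
    have n1 : 0 ≤ dirichletEnergy κ π f := dirichletEnergy_nonneg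
    have n2 : 0 ≤ dirichletEnergy κ π g := dirichletEnergy_nonneg
    have n3 : 0 ≤ ∫ x, f x ^ 2 ∂π := integral_nonneg fun _ ↦ sq_nonneg _
    have n4 : 0 ≤ ∫ x, g x ^ 2 ∂π := integral_nonneg fun _ ↦ sq_nonneg _
    rw [← ENNReal.ofReal_add (by positivity) (by positivity)]
    exact ENNReal.ofReal_le_ofReal (le_of_eq (by ring))
  have := sq_mul_le_of_forall_mul_ofReal_le hV (by rw [hA]; linarith)
    (by
      rw [hA, ha]
      linarith [integral_le_setIntegral_add (π := π) hΩ ((hm.sub_const m).pow_const 2) hsq])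
    hΦ (add_nonneg dirichletEnergy_nonneg dirichletEnergy_nonneg)
  exact ⟨this.1, by linarith [this.2]⟩

lemma sq_truncatedProfile_mul_le [IsProbabilityMeasure π] [IsMarkovKernel κ]
    (hinv : Kernel.Invariant κ π) {Ω : Set X} (hΩ : MeasurableSet Ω)
    (hm : Measurable h) (hb : ∀ x, h x ∈ Set.Icc 0 B) (hB : 0 ≤ B) (h1 : ∫ x, h x ∂π = 1)
    {V : ℝ} (hV : 0 < V) (hVh : ∫ x, h x ^ 2 ∂π = V + 1)
    (hΩB : B ^ 2 * π.real Ωᶜ ≤ V / 3) :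
    truncatedProfile κ π Ω (6 / V) ≠ ∞ ∧
      (truncatedProfile κ π Ω (6 / V)).toReal ^ 2 * V ≤ 6 * dirichletEnergy κ π h := by
  unfold truncatedProfile
  split_ifs with hv
  · exact sq_conductanceProfile_mul_le_of_level hinv hΩ hm hb h1 hV hVh hΩB
  · exact sq_conductanceProfile_mul_le_of_median hinv hΩ hm hb hB h1 hV hVh hΩB

lemma conductanceProfile_antitone (Ω : Set X) : Antitone (conductanceProfile κ π Ω) := by
  intro v w hvw
  refine le_iInf fun S ↦ le_iInf fun hS ↦ le_iInf fun h0 ↦ le_iInf fun hv ↦ ?_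
  exact iInf_le_of_le S (iInf_le_of_le hS (iInf_le_of_le h0
    (iInf_le_of_le (hv.trans (ENNReal.ofReal_le_ofReal hvw)) le_rfl)))

lemma truncatedProfile_eq (Ω : Set X) (v : ℝ) :
    truncatedProfile κ π Ω v = conductanceProfile κ π Ω (min v (π.real Ω / 2)) := by
  unfold truncatedProfile
  split_ifs with hv
  · rw [min_eq_left hv]
  · rw [min_eq_right (not_le.1 hv).le]

lemma truncatedProfile_antitone (Ω : Set X) : Antitone (truncatedProfile κ π Ω) := by
  intro v w hvw
  rw [truncatedProfile_eq, truncatedProfile_eq]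
  exact conductanceProfile_antitone Ω (min_le_min_right _ hvw)

/-- If some set is admissible in the profile, then so is its intersection with `Ω`, whose flow is
at most its mass. The profile therefore takes no values strictly between `1` and `∞`. -/
lemma conductanceProfile_le_one [IsFiniteMeasure π] [IsMarkovKernel κ] {Ω : Set X}
    (hΩ : MeasurableSet Ω) {v : ℝ} (hfin : conductanceProfile κ π Ω v ≠ ∞) :
    conductanceProfile κ π Ω v ≤ 1 := by
  obtain ⟨S, hS, h0, hv⟩ : ∃ S, MeasurableSet S ∧ 0 < π (S ∩ Ω) ∧
      π (S ∩ Ω) ≤ ENNReal.ofReal v := by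
    by_contra! hne
    refine hfin ?_
    simp only [conductanceProfile, iInf_eq_top]
    exact fun S hS h0 hv ↦ absurd hv (hne S hS h0).not_ge
  have hSS : S ∩ Ω ∩ Ω = S ∩ Ω := by rw [Set.inter_assoc, Set.inter_self]
  refine iInf_le_of_le (S ∩ Ω) (iInf_le_of_le (hS.inter hΩ) (iInf_le_of_le (by rwa [hSS])
    (iInf_le_of_le (by rwa [hSS]) ?_)))
  rw [hSS]
  refine ENNReal.div_le_of_le_mul ?_
  rw [one_mul]
  calc flow κ π (S ∩ Ω) ≤ ∫⁻ _ in S ∩ Ω, 1 ∂π := lintegral_mono fun x ↦ prob_le_one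
    _ = π (S ∩ Ω) := by simp
end

/-! ### From the dissipation of variance to the integral -/

lemma mul_le_setLIntegral_Ioc {G : ℝ → ℝ≥0∞} (hG : Antitone G) (ζ : ℝ) (a b : ℝ) :
    8 / (ENNReal.ofReal ζ * ENNReal.ofReal b * G a ^ 2) * ENNReal.ofReal (b - a) ≤
      ∫⁻ v in Set.Ioc a b, 8 / (ENNReal.ofReal ζ * ENNReal.ofReal v * G v ^ 2) := by
  rw [← Real.volume_Ioc, ← setLIntegral_const]
  refine setLIntegral_mono' measurableSet_Ioc fun v hv ↦ ?_
  have h1 := ENNReal.ofReal_le_ofReal hv.2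
  have h2 := hG hv.1.le
  gcongr

/-- A zero of `G` is treated separately: a step may then leave `V` unchanged, and the interval
belonging to it is empty. -/
lemma setLIntegral_Ioc_eq_top {G : ℝ → ℝ≥0∞} (hG : Antitone G) (ζ : ℝ) {a b : ℝ}
    (hab : a < b) (h0 : G a = 0) :
    ∫⁻ v in Set.Ioc a b, 8 / (ENNReal.ofReal ζ * ENNReal.ofReal v * G v ^ 2) = ∞ := by
  refine top_le_iff.1 (le_trans (le_of_eq ?_) (mul_le_setLIntegral_Ioc hG ζ a b))
  rw [h0, zero_pow two_ne_zero, mul_zero, ENNReal.div_zero (by norm_num), ENNReal.top_mul]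
  simpa using hab

/-- An interval contributes at least `1` as soon as its relative length `(b - a) / b` is at least
`ζ G(a)² / 8`. -/
lemma one_le_setLIntegral_Ioc {G : ℝ → ℝ≥0∞} (hG : Antitone G) {ζ : ℝ} (hζ : 0 < ζ) {a b : ℝ}
    (hb : 0 < b) (hfin : G a ≠ ∞) (h0 : G a ≠ 0)
    (hab : ζ * (G a).toReal ^ 2 * b ≤ 8 * (b - a)) :
    1 ≤ ∫⁻ v in Set.Ioc a b, 8 / (ENNReal.ofReal ζ * ENNReal.ofReal v * G v ^ 2) := by
  refine le_trans ?_ (mul_le_setLIntegral_Ioc hG ζ a b)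
  have hg : 0 < (G a).toReal := ENNReal.toReal_pos h0 hfin
  set g := (G a).toReal with hgdef
  have h8 : (8 : ℝ≥0∞) = ENNReal.ofReal 8 := by norm_num
  rw [← ENNReal.ofReal_toReal hfin, ← hgdef, ← ENNReal.ofReal_pow hg.le,
    ← ENNReal.ofReal_mul hζ.le, ← ENNReal.ofReal_mul (by positivity), h8,
    ← ENNReal.ofReal_div_of_pos (by positivity), ← ENNReal.ofReal_mul (by positivity),
    ← ENNReal.ofReal_one]
  refine ENNReal.ofReal_le_ofReal ?_
  rw [div_mul_eq_mul_div, le_div_iff₀ (by positivity)]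
  linarith

/-- Discrete comparison. With `v k = 6 / V k`, the relative length of each interval
`(v k, v (k + 1)]` is at least `ζ G(v k)² / 6`, so it contributes at least `1` if `G(v k) ≠ 0`. The step after time
`n` may end below the level `δ`; it is paid for by the interval `(6 / δ, 8 / δ]`. -/
lemma natCast_le_setLIntegral_Ioc {G : ℝ → ℝ≥0∞} (hG : Antitone G) {ζ : ℝ} (hζ : 0 < ζ)
    (hζ1 : ζ ≤ 1) {δ : ℝ} (hδ : 0 < δ) (n : ℕ) (V : ℕ → ℝ) (hV : ∀ k ≤ n, δ < V k)
    (h1 : ∀ k ≤ n, G (6 / V k) ≤ 1)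
    (hstep : ∀ k ≤ n, V (k + 1) ≤ V k - ζ * ((G (6 / V k)).toReal ^ 2 * V k / 6)) :
    ((n + 1 : ℕ) : ℝ≥0∞) ≤ ∫⁻ v in Set.Ioc (6 / V 0) (8 / δ),
      8 / (ENNReal.ofReal ζ * ENNReal.ofReal v * G v ^ 2) := by
  have hlt : ∀ k ≤ n, 6 / V k < 6 / δ := fun k hk ↦
    div_lt_div_of_pos_left (by norm_num) hδ (hV k hk)
  have h68 : 6 / δ < 8 / δ := by gcongr; norm_num
  induction n generalizing V with
  | zero =>
    have hfin : G (6 / V 0) ≠ ∞ := ne_top_of_le_ne_top ENNReal.one_ne_top (h1 0 le_rfl)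
    rcases eq_or_ne (G (6 / V 0)) 0 with h0 | h0
    · rw [setLIntegral_Ioc_eq_top hG ζ ((hlt 0 le_rfl).trans h68) h0]
      exact le_top
    · rw [zero_add, Nat.cast_one]
      refine one_le_setLIntegral_Ioc hG hζ (by positivity) hfin h0 ?_
      have hg1 : (G (6 / V 0)).toReal ≤ 1 := by
        simpa using ENNReal.toReal_mono ENNReal.one_ne_top (h1 0 le_rfl)
      have hg2 : ζ * (G (6 / V 0)).toReal ^ 2 ≤ 1 :=
        mul_le_one₀ hζ1 (sq_nonneg _) (pow_le_one₀ ENNReal.toReal_nonneg hg1)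
      have hδ8 : 0 < 8 / δ := by positivity
      calc ζ * (G (6 / V 0)).toReal ^ 2 * (8 / δ) ≤ 1 * (8 / δ) := by gcongr
        _ ≤ 8 * (8 / δ - 6 / δ) := by
            rw [← sub_div, one_mul, mul_div_assoc']
            gcongr
            norm_num
        _ ≤ 8 * (8 / δ - 6 / V 0) := by linarith [hlt 0 le_rfl]
  | succ n ih =>
    have hfin : G (6 / V 0) ≠ ∞ := ne_top_of_le_ne_top ENNReal.one_ne_top (h1 0 (by omega))
    rcases eq_or_ne (G (6 / V 0)) 0 with h0 | h0
    · rw [setLIntegral_Ioc_eq_top hG ζ ((hlt 0 (by omega)).trans h68) h0]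
      exact le_top
    have hV0 : 0 < V 0 := hδ.trans (hV 0 (by omega))
    have hV1 : 0 < V 1 := hδ.trans (hV 1 (by omega))
    have hs := hstep 0 (by omega)
    rw [zero_add] at hs
    have hle : V 1 ≤ V 0 := hs.trans (sub_le_self _ (by positivity))
    have hlast : 6 / V 1 ≤ 8 / δ := ((hlt 1 (by omega)).trans h68).le
    have hab : 6 / V 0 ≤ 6 / V 1 := by gcongr
    have hrest := ih (fun k ↦ V (k + 1)) (fun k hk ↦ hV _ (by omega)) (fun k hk ↦ h1 _ (by omega))
      (fun k hk ↦ hstep _ (by omega)) (fun k hk ↦ hlt _ (by omega))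
    rw [← Set.Ioc_union_Ioc_eq_Ioc hab hlast,
      lintegral_union measurableSet_Ioc (Set.Ioc_disjoint_Ioc_of_le le_rfl), Nat.cast_succ, add_comm]
    refine add_le_add ?_ hrest
    refine one_le_setLIntegral_Ioc hG hζ (by positivity) hfin h0 ?_
    set q := (G (6 / V 0)).toReal ^ 2 with hq
    have hq0 : 0 ≤ ζ * q := by positivity
    have key : 0 ≤ 8 * (V 0 - V 1) - ζ * q * V 0 := by nlinarith
    have e : 8 * (6 / V 1 - 6 / V 0) - ζ * q * (6 / V 1) =
        6 / (V 0 * V 1) * (8 * (V 0 - V 1) - ζ * q * V 0) := by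
      field_simp
    have : 0 ≤ 6 / (V 0 * V 1) * (8 * (V 0 - V 1) - ζ * q * V 0) := by positivity
    linarith

section

/-! ### Warm starts and the mixing time -/

variable {X : Type*} [MeasurableSpace X] {κ : Kernel X X} {π : Measure X}

lemma IsWarm.apply_le {β : ℝ} {μ₀ : Measure X} [IsFiniteMeasure π] (hw : IsWarm β π μ₀)
    {S : Set X} (hS : MeasurableSet S) : μ₀ S ≤ ENNReal.ofReal β * π S := by
  have h1 : μ₀ S / π S ≤ ENNReal.ofReal β := (le_iSup₂_of_le S hS le_rfl).trans hw
  rcases eq_or_ne (π S) 0 with h0 | h0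
  · rcases eq_or_ne (μ₀ S) 0 with hμ | hμ
    · simp [hμ]
    · rw [h0, ENNReal.div_zero hμ, top_le_iff] at h1
      exact absurd h1 ENNReal.ofReal_ne_top
  · exact (ENNReal.div_le_iff h0 (measure_ne_top _ _)).1 h1

lemma IsWarm.one_le {β : ℝ} {μ₀ : Measure X} [IsProbabilityMeasure π] [IsProbabilityMeasure μ₀]
    (hw : IsWarm β π μ₀) : 1 ≤ β := by
  have h := hw.apply_le MeasurableSet.univ
  rw [measure_univ, measure_univ, mul_one] at h
  exact ENNReal.one_le_ofReal.1 h

/-- A warm start has an everywhere defined density with values in `[0, β]`. -/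
lemma IsWarm.exists_density {β : ℝ} {μ₀ : Measure X} [IsProbabilityMeasure π]
    [IsProbabilityMeasure μ₀] (hw : IsWarm β π μ₀) :
    ∃ h : X → ℝ, Measurable h ∧ (∀ x, h x ∈ Set.Icc 0 β) ∧
      μ₀ = π.withDensity fun x ↦ ENNReal.ofReal (h x) := by
  have hβ : 0 ≤ β := zero_le_one.trans hw.one_le
  have hac : μ₀ ≪ π := Measure.AbsolutelyContinuous.mk fun S hS h0 ↦ by
    simpa [h0] using hw.apply_le hS
  have hle : μ₀.rnDeriv π ≤ᵐ[π] fun _ ↦ ENNReal.ofReal β := by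
    refine ae_le_of_forall_setLIntegral_le_of_sigmaFinite (Measure.measurable_rnDeriv _ _)
      fun S hS _ ↦ ?_
    rw [Measure.setLIntegral_rnDeriv hac, setLIntegral_const]
    exact hw.apply_le hS
  refine ⟨fun x ↦ min (μ₀.rnDeriv π x).toReal β,
    (Measure.measurable_rnDeriv _ _).ennreal_toReal.min measurable_const,
    fun x ↦ ⟨le_min ENNReal.toReal_nonneg hβ, min_le_right _ _⟩, ?_⟩
  conv_lhs => rw [← Measure.withDensity_rnDeriv_eq _ _ hac]
  refine withDensity_congr_ae ?_
  filter_upwards [hle] with x hx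
  have hfin : μ₀.rnDeriv π x ≠ ∞ := ne_top_of_le_ne_top ENNReal.ofReal_ne_top hx
  rw [min_eq_left (ENNReal.toReal_le_of_le_ofReal hβ hx), ENNReal.ofReal_toReal hfin]

lemma lpDivergence_two_withDensity_le [IsProbabilityMeasure π] {h : X → ℝ} {B ε : ℝ}
    (hm : Measurable h) (hb : ∀ x, h x ∈ Set.Icc 0 B) (h1 : ∫ x, h x ∂π = 1) (hε : 0 ≤ ε)
    (hV : ∫ x, h x ^ 2 ∂π - 1 ≤ ε ^ 2) :
    lpDivergence 2 (π.withDensity fun x ↦ ENNReal.ofReal (h x)) π ≤ ENNReal.ofReal ε := by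
  rw [lpDivergence, if_pos (withDensity_absolutelyContinuous _ _)]
  have ih := integrable_of_bounds (μ := π) hm 0 B hb
  have ih2 := integrable_of_bounds (μ := π) (hm.pow_const 2) 0 _ (sq_mem_Icc hb)
  have e : ∀ x, (h x - 1) ^ 2 = h x ^ 2 - 2 * h x + 1 := fun x ↦ by ring
  have i12 : Integrable (fun x ↦ h x ^ 2 - 2 * h x) π := ih2.sub (ih.const_mul _)
  have hint : Integrable (fun x ↦ (h x - 1) ^ 2) π := by
    simp_rw [e]
    exact i12.add (integrable_const _)
  have hval : ∫ x, (h x - 1) ^ 2 ∂π = ∫ x, h x ^ 2 ∂π - 1 := by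
    simp_rw [e]
    rw [integral_add i12 (integrable_const _), integral_sub ih2 (ih.const_mul _),
      integral_const_mul, h1, integral_const, probReal_univ, one_smul]
    ring
  have hlint : ∫⁻ x, ENNReal.ofReal (|((π.withDensity fun x ↦ ENNReal.ofReal (h x)).rnDeriv
      π x).toReal - 1| ^ (2 : ℝ)) ∂π = ENNReal.ofReal (∫ x, h x ^ 2 ∂π - 1) := by
    rw [← hval, ofReal_integral_eq_lintegral_ofReal hint
      (Filter.Eventually.of_forall fun x ↦ sq_nonneg _)]
    refine lintegral_congr_ae ?_
    filter_upwards [Measure.rnDeriv_withDensity π hm.ennreal_ofReal] with x hx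
    rw [hx, ENNReal.toReal_ofReal (hb x).1, Real.rpow_two, sq_abs]
  rw [hlint]
  calc ENNReal.ofReal (∫ x, h x ^ 2 ∂π - 1) ^ (1 / 2 : ℝ)
      ≤ ENNReal.ofReal (ε ^ 2) ^ (1 / 2 : ℝ) := by gcongr
    _ = ENNReal.ofReal ε := by
        rw [ENNReal.ofReal_rpow_of_nonneg (sq_nonneg _) (by norm_num), ← Real.sqrt_eq_rpow,
          Real.sqrt_sq hε]

/-- The hypothesis says that if the chain is not mixed at any of the times `0, …, n`, then
`n + 1 ≤ I`; this covers an infinite mixing time, where it forces `I = ∞`. -/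
lemma mixingTime_le_of_forall {p ε : ℝ} {μ₀ : Measure X} {I : ℝ≥0∞}
    (H : ∀ n : ℕ, (∀ k ≤ n, ¬ lpDivergence p ((transitionOp κ)^[k] μ₀) π ≤ ENNReal.ofReal ε) →
      ((n + 1 : ℕ) : ℝ≥0∞) ≤ I) :
    (mixingTime p κ π μ₀ ε : ℝ≥0∞) ≤ I := by
  classical
  by_cases hex : ∃ k, lpDivergence p ((transitionOp κ)^[k] μ₀) π ≤ ENNReal.ofReal ε
  · have hle : mixingTime p κ π μ₀ ε ≤ (Nat.find hex : ℕ∞) :=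
      iInf₂_le (Nat.find hex) (Nat.find_spec hex)
    refine (ENat.toENNReal_le.2 hle).trans ?_
    rw [ENat.toENNReal_coe]
    rcases hn : Nat.find hex with _ | n
    · simp
    · exact H n fun k hk ↦ Nat.find_min hex (by omega)
  · push Not at hex
    have hI : I = ∞ := ENNReal.eq_top_of_forall_nnreal_le fun r ↦ by
      obtain ⟨n, hn⟩ := exists_nat_ge r
      refine le_trans ?_ (H n fun k _ ↦ (hex k).not_ge)
      exact_mod_cast hn.trans (by simp)
    rw [hI]
    exact le_top
end
end ConductanceMixing

open ConductanceMixing in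
theorem lemma1 {X : Type*} [MeasurableSpace X]
    (ref : Measure X) [SigmaFinite ref]
    (π : Measure X) [IsProbabilityMeasure π]
    (r : X → ℝ≥0∞) (hr : Measurable r) (hπ : π = ref.withDensity r)
    (κ : Kernel X X) [IsMarkovKernel κ]
    (hrev : Kernel.IsReversible κ π)
    (hirr : Kernel.IsIrreducible π κ)
    (ζ : ℝ) (hζ0 : 0 < ζ) (hζ1 : ζ ≤ 1)
    (hlazy : ConductanceMixing.IsLazy ζ κ)
    (hsmooth : ConductanceMixing.IsSmoothChain ref κ)
    (ε : ℝ) (hε : 0 < ε)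
    (β : ℝ) (μ₀ : Measure X) [IsProbabilityMeasure μ₀]
    (hwarm : ConductanceMixing.IsWarm β π μ₀)
    (Ω : Set X) (hΩ : MeasurableSet Ω)
    (hΩmass : 1 - ε ^ 2 / (3 * β ^ 2) ≤ π.real Ω) :
    (ConductanceMixing.mixingTime 2 κ π μ₀ ε : ℝ≥0∞) ≤
      ∫⁻ v in Set.Icc (4 / β) (8 / ε ^ 2),
        8 / (ENNReal.ofReal ζ * ENNReal.ofReal v *
          ConductanceMixing.truncatedProfile κ π Ω v ^ 2) := by
  have hinv : Kernel.Invariant κ π := hrev.invariant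
  have hβ1 := hwarm.one_le
  have hβ : 0 < β := zero_lt_one.trans_le hβ1
  obtain ⟨h₀, hm₀, hb₀, hμ₀⟩ := hwarm.exists_density
  set h : ℕ → X → ℝ := fun n ↦ (average κ)^[n] h₀ with hh
  have hsucc : ∀ n, h (n + 1) = average κ (h n) := fun n ↦ Function.iterate_succ_apply' _ _ _
  have hmb : ∀ n, Measurable (h n) ∧ ∀ x, h n x ∈ Set.Icc 0 β := by
    intro n
    induction n with
    | zero => exact ⟨hm₀, hb₀⟩
    | succ n ih =>
      rw [hsucc]
      exact ⟨measurable_average ih.1, average_mem_Icc ih.1 ih.2⟩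
  have hμ : ∀ n, (transitionOp κ)^[n] μ₀ = π.withDensity fun x ↦ ENNReal.ofReal (h n x) := by
    intro n
    induction n with
    | zero => exact hμ₀
    | succ n ih =>
      rw [Function.iterate_succ_apply', ih, transitionOp_withDensity hrev (hmb n).1 (hmb n).2,
        hsucc]
  have hone : ∀ n, ∫ x, h n x ∂π = 1 := by
    intro n
    induction n with
    | zero =>
      have huniv : μ₀ Set.univ = 1 := measure_univ
      rw [hμ₀, withDensity_apply _ MeasurableSet.univ, Measure.restrict_univ,
        ← ofReal_integral_eq_lintegral_ofReal (integrable_of_bounds hm₀ 0 β hb₀)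
          (Filter.Eventually.of_forall fun x ↦ (hb₀ x).1)] at huniv
      exact ENNReal.ofReal_eq_one.1 huniv
    | succ n ih => rw [hsucc, integral_average hinv (hmb n).1 (hmb n).2, ih]
  -- `V n` is the variance of the density at time `n`, that is, the squared divergence.
  set V : ℕ → ℝ := fun n ↦ ∫ x, h n x ^ 2 ∂π - 1 with hVdef
  have hVh : ∀ n, ∫ x, h n x ^ 2 ∂π = V n + 1 := fun n ↦ by simp [hVdef]
  refine mixingTime_le_of_forall fun n hn ↦ ?_
  have hVε : ∀ k ≤ n, ε ^ 2 < V k := by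
    intro k hk
    by_contra! hle
    exact hn k hk (by
      rw [hμ k]
      exact lpDivergence_two_withDensity_le (hmb k).1 (hmb k).2 (hone k) hε.le hle)
  have hΩB : β ^ 2 * π.real Ωᶜ ≤ ε ^ 2 / 3 := by
    rw [probReal_compl_eq_one_sub hΩ]
    calc β ^ 2 * (1 - π.real Ω) ≤ β ^ 2 * (ε ^ 2 / (3 * β ^ 2)) := by gcongr; linarith
      _ = ε ^ 2 / 3 := by field_simp
  have henergy : ∀ k ≤ n, truncatedProfile κ π Ω (6 / V k) ≠ ∞ ∧
      (truncatedProfile κ π Ω (6 / V k)).toReal ^ 2 * V k ≤ 6 * dirichletEnergy κ π (h k) :=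
    fun k hk ↦ sq_truncatedProfile_mul_le hinv hΩ (hmb k).1 (hmb k).2 hβ.le (hone k)
      ((sq_nonneg ε).trans_lt (hVε k hk)) (hVh k) (hΩB.trans (by linarith [hVε k hk]))
  have hstep : ∀ k ≤ n, V (k + 1) ≤
      V k - ζ * ((truncatedProfile κ π Ω (6 / V k)).toReal ^ 2 * V k / 6) := by
    intro k hk
    have h1 := integral_sq_average_le hinv hζ0.le hζ1 hlazy (hmb k).1 (hmb k).2
    rw [← hsucc, hVh, hVh] at h1
    have h2 : ζ * ((truncatedProfile κ π Ω (6 / V k)).toReal ^ 2 * V k / 6) ≤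
        ζ * dirichletEnergy κ π (h k) := by
      gcongr
      linarith [(henergy k hk).2]
    linarith
  have hle1 : ∀ k ≤ n, truncatedProfile κ π Ω (6 / V k) ≤ 1 := by
    intro k hk
    have hfin := (henergy k hk).1
    rw [truncatedProfile_eq] at hfin ⊢
    exact conductanceProfile_le_one hΩ hfin
  have hV0 : V 0 ≤ β := by
    have h1 : ∫ x, h 0 x ^ 2 ∂π ≤ ∫ x, β * h 0 x ∂π := by
      refine integral_mono
        (integrable_of_bounds ((hmb 0).1.pow_const 2) 0 _ (sq_mem_Icc (hmb 0).2))
        ((integrable_of_bounds (hmb 0).1 0 β (hmb 0).2).const_mul _) fun x ↦ ?_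
      have := (hmb 0).2 x
      dsimp only
      nlinarith [this.1, this.2]
    rw [integral_const_mul, hone, hVh] at h1
    linarith
  have hV0pos : 0 < V 0 := (sq_nonneg ε).trans_lt (hVε 0 n.zero_le)
  refine (natCast_le_setLIntegral_Ioc (truncatedProfile_antitone Ω) hζ0 hζ1 (by positivity) n V
    hVε hle1 hstep).trans (lintegral_mono_set fun v hv ↦ ⟨?_, hv.2⟩)
  calc 4 / β ≤ 6 / V 0 := by gcongr; norm_num
    _ ≤ v := hv.1.le
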